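/- Let $k\ge 1$ and $m,n\ge k$ be integers with $m\neq n$, let $\mathbb K=\mathbb R$ or $\mathbb C$, and let $$A=\begin{bmatrix}\widehat\Sigma & E^*\\ F & A_2\end{bmatrix}\in\mathbb K^{m\times n},\qquad \widehat\Sigma=\mathrm{diag}(\theta_1,\dots,\theta_k),\quad \theta_j\in\mathbb R,$$ where $E=[E_1,\dots,E_k]\in\mathbb K^{(n-k)\times k}$ and $F=[F_1,\dots,F_k]\in\mathbb K^{(m-k)\times k}$ have columns $E_j$, $F_j$, and $A_2\in\mathbb K^{(m-k)\times(n-k)}$ has singular values $\sigma_j(A_2)$, $1\le j\le\min(m-k,n-k)$. Let $\|\cdot\|_2$ be the Euclidean norm. Fix $i\in\{1,\dots,k\}$ with $\theta_i\ge 0$ and suppose that \begin{align*} \delta_i&=\min\bigl(|\theta_i|,\ \min_j|\theta_i-\sigma_j(A_2)|\bigr)-\sqrt{(\|E_i\|_2^2+\|F_i\|_2^2)/2}>0,\\ \delta_{i,j}&=|\theta_i-\theta_j|-\sqrt{(\|E_i\|_2^2+\|F_i\|_2^2)/2}>0\quad\text{for }1\le j\le k,\ j\ne i,\\ \delta'_{i,j}&=|\theta_i+\theta_j|-\sqrt{(\|E_i\|_2^2+\|F_i\|_2^2)/2}>0\quad\text{for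 }1\le j\le k \end{align*} (the inner minimum in $\delta_i$ is omitted if $\min(m,n)=k$), and that $$d_i=\frac{1}{\delta_i-\sum_{1\le j\le k,\ j\ne i}\dfrac{\|E_j\|_2^2+\|F_j\|_2^2}{2\delta_{i,j}}-\sum_{1\le j\le k}\dfrac{\|E_j\|_2^2+\|F_j\|_2^2}{2\delta'_{i,j}}}>0.$$ Then there exists a singular value $\sigma_i$ of $A$ such that $$|\sigma_i-\theta_i|\le d_i\,\frac{\|E_i\|_2^2+\|F_i\|_2^2}{2}.$$ -/

import Mathlib

noncomputable section

open Matrix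

/-- The Euclidean norm `‖X_j‖₂` of the `j`-th column of `X`. -/
def colNorm {𝕜 ι κ : Type*} [RCLike 𝕜] [Fintype ι] (X : Matrix ι κ 𝕜) (j : κ) : ℝ :=
  ‖(WithLp.toLp 2 (X.col j) : EuclideanSpace 𝕜 ι)‖

/-- The singular values `σ_1 ≥ σ_2 ≥ ⋯` of an `m × n` matrix, in decreasing order with
multiplicity; there are `min m n` of them (indexed from `0`). -/
def singVal {𝕜 ι κ : Type*} [RCLike 𝕜] [Fintype ι] [Fintype κ] [DecidableEq κ]
    (X : Matrix ι κ 𝕜) (j : Fin (min (Fintype.card ι) (Fintype.card κ))) : ℝ :=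
  X.toEuclideanLin.singularValues j

section Gaps

variable {𝕜 : Type*} [RCLike 𝕜] {k p q : ℕ}

/-- The block matrix `[[diag θ, E*], [F, A₂]]`, with `m = k + p` rows and `n = k + q` columns. -/
def blockMatrix (θ : Fin k → ℝ) (E : Matrix (Fin q) (Fin k) 𝕜) (F : Matrix (Fin p) (Fin k) 𝕜)
    (A₂ : Matrix (Fin p) (Fin q) 𝕜) : Matrix (Fin k ⊕ Fin p) (Fin k ⊕ Fin q) 𝕜 :=
  fromBlocks (diagonal fun j => (θ j : 𝕜)) Eᴴ F A₂

/-- `(‖E_j‖² + ‖F_j‖²) / 2`. -/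
def resSq (E : Matrix (Fin q) (Fin k) 𝕜) (F : Matrix (Fin p) (Fin k) 𝕜) (j : Fin k) : ℝ :=
  (colNorm E j ^ 2 + colNorm F j ^ 2) / 2

/-- `δ_i = min (|θ_i|, min_j |θ_i - σ_j(A₂)|) - √((‖E_i‖² + ‖F_i‖²) / 2)`. The minimum is over a
finite set that always contains `|θ_i|`, also when `A₂` is empty. -/
def gapA (θ : Fin k → ℝ) (E : Matrix (Fin q) (Fin k) 𝕜) (F : Matrix (Fin p) (Fin k) 𝕜)
    (A₂ : Matrix (Fin p) (Fin q) 𝕜) (i : Fin k) : ℝ :=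
  (insert |θ i| (Finset.univ.image fun j => |θ i - singVal A₂ j|)).min'
      (Finset.insert_nonempty _ _)
    - √(resSq E F i)

/-- `δ_{i,j} = |θ_i - θ_j| - √((‖E_i‖² + ‖F_i‖²) / 2)`. -/
def gapMinus (θ : Fin k → ℝ) (E : Matrix (Fin q) (Fin k) 𝕜) (F : Matrix (Fin p) (Fin k) 𝕜)
    (i j : Fin k) : ℝ :=
  |θ i - θ j| - √(resSq E F i)

/-- `δ'_{i,j} = |θ_i + θ_j| - √((‖E_i‖² + ‖F_i‖²) / 2)`. -/
def gapPlus (θ : Fin k → ℝ) (E : Matrix (Fin q) (Fin k) 𝕜) (F : Matrix (Fin p) (Fin k) 𝕜)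
    (i j : Fin k) : ℝ :=
  |θ i + θ j| - √(resSq E F i)

/-- The coefficient `d_i`. -/
def coeffD (θ : Fin k → ℝ) (E : Matrix (Fin q) (Fin k) 𝕜) (F : Matrix (Fin p) (Fin k) 𝕜)
    (A₂ : Matrix (Fin p) (Fin q) 𝕜) (i : Fin k) : ℝ :=
  1 / (gapA θ E F A₂ i
      - ∑ j ∈ Finset.univ.erase i,
          (colNorm E j ^ 2 + colNorm F j ^ 2) / (2 * gapMinus θ E F i j)
      - ∑ j : Fin k, (colNorm E j ^ 2 + colNorm F j ^ 2) / (2 * gapPlus θ E F i j))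

end Gaps

end

/-! The Jordan–Wielandt operator `(u, v) ↦ (A v, A* u)` is symmetric, and its positive eigenvalues
are singular values of `A`. The test vector `(e_i, e_i)` yields an eigenvalue `μ` with `|μ - θ_i| ≤
√r`, where `r = (‖E_i‖² + ‖F_i‖²) / 2`.

This crude bound is then sharpened using an exact eigenvector `(u, v)`. In the coordinates `u_j ±
v_j` the leading block becomes `diag(±θ_j)`, coupled to the tail `y` only through `(F_j, ±E_j)`.
Since `μ` is within `√r` of `θ_i`, each gap measured from `θ_i` and reduced by `√r` is valid at `μ`.
Hence every leading coordinate except `u_i + v_i` is controlled by `‖y‖`, and `‖y‖` is controlled by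
the leading coordinates. Eliminating all but `u_i + v_i` and `y` gives the quadratic bound
(`le_of_block_eigenvector_estimates`). -/

open Matrix Module

/-! ### Residual bounds and the Jordan–Wielandt operator -/

section Symmetric

variable {𝕜 V W : Type*} [RCLike 𝕜] [NormedAddCommGroup V] [InnerProductSpace 𝕜 V]
  [FiniteDimensional 𝕜 V] [NormedAddCommGroup W] [InnerProductSpace 𝕜 W] [FiniteDimensional 𝕜 W]

/-- An approximate eigenvector of a symmetric operator forces an eigenvalue nearby. -/
theorem LinearMap.IsSymmetric.exists_hasEigenvalue_abs_sub_le {T : V →ₗ[𝕜] V}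
    (hT : T.IsSymmetric) {x : V} (hx : x ≠ 0) {μ c : ℝ}
    (h : ‖T x - (μ : 𝕜) • x‖ ≤ c * ‖x‖) :
    ∃ l : ℝ, End.HasEigenvalue T (l : 𝕜) ∧ |l - μ| ≤ c := by
  have hc : 0 ≤ c := by
    by_contra! hc
    have := mul_neg_of_neg_of_pos hc (norm_pos_iff.2 hx)
    linarith [norm_nonneg (T x - (μ : 𝕜) • x)]
  set b := hT.eigenvectorBasis rfl
  set l := hT.eigenvalues rfl
  suffices ∃ j, |l j - μ| ≤ c by
    obtain ⟨j, hj⟩ := this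
    exact ⟨l j, hT.hasEigenvalue_eigenvalues rfl j, hj⟩
  by_contra! hl
  have hcoord : ∀ j, ‖b.repr (T x - (μ : 𝕜) • x) j‖ ^ 2 = |l j - μ| ^ 2 * ‖b.repr x j‖ ^ 2 := by
    intro j
    have : b.repr (T x - (μ : 𝕜) • x) j = ((l j - μ : ℝ) : 𝕜) * b.repr x j := by
      rw [map_sub, PiLp.sub_apply, hT.eigenvectorBasis_apply_self_apply rfl, map_smul]
      simp only [PiLp.smul_apply, smul_eq_mul, RCLike.ofReal_sub]
      ring
    rw [this, norm_mul, RCLike.norm_ofReal, mul_pow]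
  -- By Parseval, eigenvalues all farther than `c` from `μ` would force a residual above `c * ‖x‖`.
  have hlt : ∑ j, c ^ 2 * ‖b.repr x j‖ ^ 2 < ∑ j, ‖b.repr (T x - (μ : 𝕜) • x) j‖ ^ 2 := by
    obtain ⟨j, hj⟩ : ∃ j, b.repr x j ≠ 0 := by
      by_contra! h0
      exact hx (b.repr.map_eq_zero_iff.1 (PiLp.ext h0))
    have hsq : ∀ j, c ^ 2 < |l j - μ| ^ 2 := fun j => pow_lt_pow_left₀ (hl j) hc two_ne_zero
    refine Finset.sum_lt_sum (fun j _ => ?_) ⟨j, Finset.mem_univ _, ?_⟩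
    · rw [hcoord]
      exact mul_le_mul_of_nonneg_right (hsq j).le (by positivity)
    · rw [hcoord]
      exact mul_lt_mul_of_pos_right (hsq j) (by positivity)
  rw [← Finset.mul_sum, ← EuclideanSpace.norm_sq_eq, ← EuclideanSpace.norm_sq_eq,
    LinearIsometryEquiv.norm_map, LinearIsometryEquiv.norm_map, ← mul_pow] at hlt
  exact absurd (pow_le_pow_left₀ (norm_nonneg _) h 2) hlt.not_ge

/-- A symmetric operator is bounded below at distance from its spectrum. -/
theorem LinearMap.IsSymmetric.mul_norm_le_norm_sub {T : V →ₗ[𝕜] V} (hT : T.IsSymmetric)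
    {μ g : ℝ} (h : ∀ l : ℝ, End.HasEigenvalue T (l : 𝕜) → g ≤ |l - μ|) (x : V) :
    g * ‖x‖ ≤ ‖T x - (μ : 𝕜) • x‖ := by
  rcases eq_or_ne x 0 with rfl | hx
  · simp
  have hpos := norm_pos_iff.2 hx
  obtain ⟨l, hl, hle⟩ := hT.exists_hasEigenvalue_abs_sub_le hx (μ := μ)
    (c := ‖T x - (μ : 𝕜) • x‖ / ‖x‖) (div_mul_cancel₀ _ hpos.ne').ge
  exact (le_div_iff₀ hpos).1 ((h l hl).trans hle)

/-- The Jordan–Wielandt operator `(u, v) ↦ (T v, T* u)`. -/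
noncomputable def jordanWielandt (T : V →ₗ[𝕜] W) : WithLp 2 (W × V) →ₗ[𝕜] WithLp 2 (W × V) where
  toFun x := WithLp.toLp 2 (T x.snd, T.adjoint x.fst)
  map_add' x y := by simp [← WithLp.toLp_add]
  map_smul' c x := by simp [← WithLp.toLp_smul]

@[simp]
theorem jordanWielandt_fst (T : V →ₗ[𝕜] W) (x : WithLp 2 (W × V)) :
    (jordanWielandt T x).fst = T x.snd := rfl

@[simp]
theorem jordanWielandt_snd (T : V →ₗ[𝕜] W) (x : WithLp 2 (W × V)) :
    (jordanWielandt T x).snd = T.adjoint x.fst := rfl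

theorem isSymmetric_jordanWielandt (T : V →ₗ[𝕜] W) : (jordanWielandt T).IsSymmetric := by
  intro x y
  rw [WithLp.prod_inner_apply, WithLp.prod_inner_apply]
  change inner 𝕜 (T x.snd) y.fst + inner 𝕜 (T.adjoint x.fst) y.snd =
    inner 𝕜 x.fst (T y.snd) + inner 𝕜 x.snd (T.adjoint y.fst)
  rw [LinearMap.adjoint_inner_left, LinearMap.adjoint_inner_right, add_comm]

/-- The nonzero eigenvalues of the Jordan–Wielandt operator are singular values up to sign. -/
theorem exists_singularValues_eq_abs {T : V →ₗ[𝕜] W} {l : ℝ} (hl : l ≠ 0)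
    (h : End.HasEigenvalue (jordanWielandt T) (l : 𝕜)) :
    ∃ n < finrank 𝕜 T.range, T.singularValues n = |l| := by
  obtain ⟨x, hx⟩ := h.exists_hasEigenvector
  have hl' : (l : 𝕜) ≠ 0 := RCLike.ofReal_ne_zero.2 hl
  have hfst : T x.snd = (l : 𝕜) • x.fst := congrArg WithLp.fst hx.apply_eq_smul
  have hsnd : T.adjoint x.fst = (l : 𝕜) • x.snd := congrArg WithLp.snd hx.apply_eq_smul
  have hv : x.snd ≠ 0 := by
    intro h0
    rw [h0, map_zero, eq_comm, smul_eq_zero_iff_right hl'] at hfst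
    exact hx.2 (WithLp.ofLp_injective 2 (Prod.ext hfst h0))
  have heig : End.HasEigenvalue (T.adjoint ∘ₗ T) ((l ^ 2 : ℝ) : 𝕜) := by
    refine End.hasEigenvalue_of_hasEigenvector (x := x.snd) ⟨?_, hv⟩
    rw [End.mem_eigenspace_iff, LinearMap.comp_apply, hfst, map_smul, hsnd, smul_smul,
      RCLike.ofReal_pow, sq]
  obtain ⟨n, hn⟩ := T.isSymmetric_adjoint_comp_self.exists_eigenvalues_eq rfl heig
  have hval : T.singularValues n = |l| := by
    rw [T.singularValues_fin rfl, RCLike.ofReal_injective hn, Real.sqrt_sq_eq_abs]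
  exact ⟨n, T.singularValues_pos_iff_lt_finrank_range.1 (hval ▸ abs_pos.2 hl), hval⟩

end Symmetric

/-- The nonzero eigenvalues of the Jordan–Wielandt operator of a matrix are, up to sign, among its
`min m n` singular values. -/
theorem exists_singVal_eq_abs {𝕜 ι κ : Type*} [RCLike 𝕜] [Fintype ι] [Fintype κ] [DecidableEq κ]
    {X : Matrix ι κ 𝕜} {l : ℝ} (hl : l ≠ 0)
    (h : End.HasEigenvalue (jordanWielandt X.toEuclideanLin) (l : 𝕜)) :
    ∃ s, singVal X s = |l| := by
  obtain ⟨n, hn, hval⟩ := exists_singularValues_eq_abs hl h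
  have hrow := hn.trans_le (Submodule.finrank_le _)
  have hcol := hn.trans_le (LinearMap.finrank_range_le _)
  rw [finrank_euclideanSpace] at hrow hcol
  exact ⟨⟨n, lt_min hrow hcol⟩, hval⟩

/-- The scalar inequality that turns the block eigenvector equations into an eigenvalue bound:
`n` is the norm of the trailing part, `c` are the moduli of the leading coordinates. -/
theorem le_of_block_eigenvector_estimates {ι : Type*} [Fintype ι] [DecidableEq ι] (i : ι)
    {n δ : ℝ} {c G t gap : ι → ℝ} (hn : 0 ≤ n) (hc : ∀ j, 0 ≤ c j) (hG : ∀ j, 0 ≤ G j)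
    (hne : ¬ (n = 0 ∧ ∀ j, c j = 0)) (hgap : ∀ j ≠ i, 0 < gap j) (hle : ∀ j ≠ i, gap j ≤ t j)
    (hlead : ∀ j, t j * c j ≤ G j * n / 2) (htrail : δ * n ≤ ∑ j, c j * G j)
    (hD : 0 < δ - ∑ j ∈ Finset.univ.erase i, G j ^ 2 / (2 * gap j)) :
    t i ≤ 1 / (δ - ∑ j ∈ Finset.univ.erase i, G j ^ 2 / (2 * gap j)) * (G i ^ 2 / 2) := by
  set S := ∑ j ∈ Finset.univ.erase i, G j ^ 2 / (2 * gap j) with hS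
  have hcj : ∀ j ≠ i, c j ≤ G j * n / (2 * gap j) := by
    intro j hj
    rw [le_div_iff₀ (by linarith [hgap j hj])]
    nlinarith [mul_le_mul_of_nonneg_right (hle j hj) (hc j), hlead j]
  have hsum : ∑ j ∈ Finset.univ.erase i, c j * G j ≤ S * n := by
    rw [hS, Finset.sum_mul]
    refine Finset.sum_le_sum fun j hj => ?_
    calc c j * G j ≤ G j * n / (2 * gap j) * G j :=
          mul_le_mul_of_nonneg_right (hcj j (Finset.ne_of_mem_erase hj)) (hG j)
      _ = G j ^ 2 / (2 * gap j) * n := by ring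
  rw [← Finset.add_sum_erase _ _ (Finset.mem_univ i)] at htrail
  have hy : (δ - S) * n ≤ c i * G i := by linarith
  -- If `c i` vanished, the tail would vanish, and then every other coordinate, contradicting `hne`.
  have hci : 0 < c i := by
    refine (hc i).lt_of_ne' fun h0 => hne ?_
    have hn0 : n = 0 := by
      rw [h0, zero_mul] at hy
      exact le_antisymm (nonpos_of_mul_nonpos_right hy hD) hn
    refine ⟨hn0, fun j => ?_⟩
    rcases eq_or_ne j i with rfl | hj
    · exact h0
    · exact le_antisymm (by simpa [hn0] using hcj j hj) (hc j)
  refine le_of_mul_le_mul_right ?_ hci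
  calc t i * c i ≤ G i / 2 * n := by linarith [hlead i]
    _ ≤ G i / 2 * (c i * G i / (δ - S)) := by
        refine mul_le_mul_of_nonneg_left ?_ (by linarith [hG i])
        rw [le_div_iff₀ hD]
        linarith
    _ = _ := by ring

/-! ### Eigenvector equations of the block matrix -/

section Block

variable {𝕜 : Type*} [RCLike 𝕜] {k p q : ℕ}

/-- The last `p` coordinates of a vector with `k + p` coordinates. -/
def tailVec (u : EuclideanSpace 𝕜 (Fin k ⊕ Fin p)) : EuclideanSpace 𝕜 (Fin p) :=
  WithLp.toLp 2 fun a => u (Sum.inr a)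

/-- The `j`-th column of a matrix as a Euclidean vector. -/
def colVec (X : Matrix (Fin p) (Fin k) 𝕜) (j : Fin k) : EuclideanSpace 𝕜 (Fin p) :=
  WithLp.toLp 2 (X.col j)

variable (θ : Fin k → ℝ) (E : Matrix (Fin q) (Fin k) 𝕜) (F : Matrix (Fin p) (Fin k) 𝕜)
  (A₂ : Matrix (Fin p) (Fin q) 𝕜)

/-- Since `θ` is real, taking adjoints swaps `E` and `F`, so each computation for the block matrix
also serves its adjoint. -/
theorem adjoint_toEuclideanLin_blockMatrix :
    (blockMatrix θ E F A₂).toEuclideanLin.adjoint =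
      (blockMatrix θ F E A₂ᴴ).toEuclideanLin := by
  rw [← Matrix.toEuclideanLin_conjTranspose_eq_adjoint]
  congr 1
  simp only [blockMatrix, fromBlocks_conjTranspose, conjTranspose_conjTranspose,
    diagonal_conjTranspose]
  congr 2
  funext j
  simp

theorem blockMatrix_apply_inl (v : EuclideanSpace 𝕜 (Fin k ⊕ Fin q)) (j : Fin k) :
    (blockMatrix θ E F A₂).toEuclideanLin v (Sum.inl j) =
      (θ j : 𝕜) * v (Sum.inl j) + inner 𝕜 (colVec E j) (tailVec v) := by
  simp [Matrix.mulVec, dotProduct, blockMatrix,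
    Fintype.sum_sum_type, diagonal_apply, PiLp.inner_apply, colVec, tailVec, mul_comm]

theorem tailVec_blockMatrix (v : EuclideanSpace 𝕜 (Fin k ⊕ Fin q)) :
    tailVec ((blockMatrix θ E F A₂).toEuclideanLin v) =
      ∑ j, v (Sum.inl j) • colVec F j + A₂.toEuclideanLin (tailVec v) := by
  ext a
  simp [Matrix.mulVec, dotProduct, blockMatrix,
    Fintype.sum_sum_type, colVec, tailVec, mul_comm]

theorem norm_blockMatrix_single_sub (i : Fin k) :
    ‖(blockMatrix θ E F A₂).toEuclideanLin (EuclideanSpace.single (Sum.inl i) 1) -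
      (θ i : 𝕜) • EuclideanSpace.single (Sum.inl i) 1‖ = colNorm F i := by
  rw [colNorm, ← sq_eq_sq₀ (norm_nonneg _) (norm_nonneg _), EuclideanSpace.norm_sq_eq,
    EuclideanSpace.norm_sq_eq, Fintype.sum_sum_type, add_eq_right.2]
  · refine Finset.sum_congr rfl fun a _ => ?_
    simp [blockMatrix]
  · refine Finset.sum_eq_zero fun j _ => ?_
    rcases eq_or_ne j i with rfl | hj
    · simp [blockMatrix, RCLike.real_smul_eq_coe_mul]
    · simp [blockMatrix, hj]

theorem resSq_nonneg (j : Fin k) : 0 ≤ resSq E F j := by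
  unfold resSq
  positivity

/-- The block matrix has an eigenvalue of its Jordan–Wielandt operator within the residual of
`θ i`. -/
theorem exists_hasEigenvalue_blockMatrix (i : Fin k) :
    ∃ μ : ℝ, End.HasEigenvalue (jordanWielandt (blockMatrix θ E F A₂).toEuclideanLin) (μ : 𝕜) ∧
      |μ - θ i| ≤ √(resSq E F i) := by
  set x : WithLp 2 (EuclideanSpace 𝕜 (Fin k ⊕ Fin p) × EuclideanSpace 𝕜 (Fin k ⊕ Fin q)) :=
    WithLp.toLp 2 (EuclideanSpace.single (Sum.inl i) 1, EuclideanSpace.single (Sum.inl i) 1)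
    with hx
  -- This is the source of the factor 1/2 in `resSq`.
  have hnorm : ‖x‖ ^ 2 = 2 := by
    rw [WithLp.prod_norm_sq_eq_of_L2]
    simp [hx]
    norm_num
  refine (isSymmetric_jordanWielandt _).exists_hasEigenvalue_abs_sub_le (x := x) ?_ ?_
  · intro h0
    simp [h0] at hnorm
  · rw [← sq_le_sq₀ (norm_nonneg _) (by positivity), mul_pow, hnorm,
      Real.sq_sqrt (resSq_nonneg E F i), WithLp.prod_norm_sq_eq_of_L2]
    simp only [WithLp.sub_fst, WithLp.sub_snd, WithLp.smul_fst, WithLp.smul_snd,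
      jordanWielandt_fst, jordanWielandt_snd, adjoint_toEuclideanLin_blockMatrix]
    simp only [hx, WithLp.toLp_fst, WithLp.toLp_snd, norm_blockMatrix_single_sub, resSq]
    linarith

/-- Positive eigenvalues are singular values of `A₂`; nonpositive ones lie at distance at least `θ
i`, which is why `|θ i|` enters the minimum. -/
theorem gapA_add_le_abs {i : Fin k} (hθ : 0 ≤ θ i) {l : ℝ}
    (h : End.HasEigenvalue (jordanWielandt A₂.toEuclideanLin) (l : 𝕜)) :
    gapA θ E F A₂ i + √(resSq E F i) ≤ |l - θ i| := by
  rw [gapA, sub_add_cancel]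
  have hzero := Finset.min'_le (insert |θ i| (Finset.univ.image fun j => |θ i - singVal A₂ j|))
    _ (Finset.mem_insert_self _ _)
  rcases le_or_gt l 0 with hl | hl
  · refine hzero.trans ?_
    rw [abs_of_nonneg hθ, abs_of_nonpos (by linarith)]
    linarith
  · obtain ⟨s, hs⟩ := exists_singVal_eq_abs hl.ne' h
    rw [abs_of_pos hl] at hs
    rw [abs_sub_comm, ← hs]
    exact Finset.min'_le _ _ (Finset.mem_insert_of_mem
      (Finset.mem_image_of_mem _ (Finset.mem_univ s)))

theorem sqrt_resSq_lt {i : Fin k} (hθ : 0 ≤ θ i) (hδ : 0 < gapA θ E F A₂ i) :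
    √(resSq E F i) < θ i := by
  rw [gapA, sub_pos] at hδ
  refine (hδ.trans_le (Finset.min'_le _ _ (Finset.mem_insert_self _ _))).trans_eq
    (abs_of_nonneg hθ)

/-- The common norm of the vectors `(F_j, ±E_j)`. -/
noncomputable def pairNorm (j : Fin k) : ℝ := √(colNorm E j ^ 2 + colNorm F j ^ 2)

theorem pairNorm_sq (j : Fin k) : pairNorm E F j ^ 2 = colNorm E j ^ 2 + colNorm F j ^ 2 :=
  Real.sq_sqrt (by positivity)

theorem norm_toLp_colVec (j : Fin k) :
    ‖WithLp.toLp 2 (colVec F j, colVec E j)‖ = pairNorm E F j := by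
  rw [WithLp.prod_norm_eq_of_L2, pairNorm, add_comm]
  rfl

theorem norm_toLp_colVec_neg (j : Fin k) :
    ‖WithLp.toLp 2 (colVec F j, -colVec E j)‖ = pairNorm E F j := by
  rw [WithLp.prod_norm_eq_of_L2, pairNorm, add_comm]
  simp only [WithLp.toLp_snd, norm_neg]
  rfl

variable {θ E F A₂} {u : EuclideanSpace 𝕜 (Fin k ⊕ Fin p)}
  {v : EuclideanSpace 𝕜 (Fin k ⊕ Fin q)} {μ : ℝ}

/-- Adding the two `j`-th leading equations diagonalizes them; Cauchy–Schwarz bounds the coupling.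
Subtracting them gives the companion estimate for `μ + θ j`. -/
theorem abs_sub_mul_norm_add_le
    (hu : (blockMatrix θ E F A₂).toEuclideanLin v = (μ : 𝕜) • u)
    (hv : (blockMatrix θ F E A₂ᴴ).toEuclideanLin u = (μ : 𝕜) • v) (j : Fin k) :
    |μ - θ j| * (‖u (Sum.inl j) + v (Sum.inl j)‖ / 2) ≤
      pairNorm E F j * ‖WithLp.toLp 2 (tailVec u, tailVec v)‖ / 2 := by
  have h1 := congrArg (fun w => w.ofLp (Sum.inl j)) hu
  have h2 := congrArg (fun w => w.ofLp (Sum.inl j)) hv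
  simp only [blockMatrix_apply_inl, PiLp.smul_apply, smul_eq_mul] at h1 h2
  have key : ((μ - θ j : ℝ) : 𝕜) * (u (Sum.inl j) + v (Sum.inl j)) =
      inner 𝕜 (WithLp.toLp 2 (colVec F j, colVec E j))
        (WithLp.toLp 2 (tailVec u, tailVec v)) := by
    rw [WithLp.prod_inner_apply]
    simp only [RCLike.ofReal_sub]
    linear_combination -h1 - h2
  have hle := norm_inner_le_norm (𝕜 := 𝕜) (WithLp.toLp 2 (colVec F j, colVec E j))
    (WithLp.toLp 2 (tailVec u, tailVec v))
  rw [← key, norm_mul, RCLike.norm_ofReal, norm_toLp_colVec] at hle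
  linarith

theorem abs_add_mul_norm_sub_le
    (hu : (blockMatrix θ E F A₂).toEuclideanLin v = (μ : 𝕜) • u)
    (hv : (blockMatrix θ F E A₂ᴴ).toEuclideanLin u = (μ : 𝕜) • v) (j : Fin k) :
    |μ + θ j| * (‖u (Sum.inl j) - v (Sum.inl j)‖ / 2) ≤
      pairNorm E F j * ‖WithLp.toLp 2 (tailVec u, tailVec v)‖ / 2 := by
  have h1 := congrArg (fun w => w.ofLp (Sum.inl j)) hu
  have h2 := congrArg (fun w => w.ofLp (Sum.inl j)) hv
  simp only [blockMatrix_apply_inl, PiLp.smul_apply, smul_eq_mul] at h1 h2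
  have key : ((μ + θ j : ℝ) : 𝕜) * (u (Sum.inl j) - v (Sum.inl j)) =
      -inner 𝕜 (WithLp.toLp 2 (colVec F j, -colVec E j))
        (WithLp.toLp 2 (tailVec u, tailVec v)) := by
    rw [WithLp.prod_inner_apply]
    simp only [RCLike.ofReal_add, inner_neg_left]
    linear_combination -h1 + h2
  have hle := norm_inner_le_norm (𝕜 := 𝕜) (WithLp.toLp 2 (colVec F j, -colVec E j))
    (WithLp.toLp 2 (tailVec u, tailVec v))
  rw [← norm_neg, ← key, norm_mul, RCLike.norm_ofReal, norm_toLp_colVec_neg] at hle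
  linarith

theorem norm_jordanWielandt_tail_sub_le
    (hu : (blockMatrix θ E F A₂).toEuclideanLin v = (μ : 𝕜) • u)
    (hv : (blockMatrix θ F E A₂ᴴ).toEuclideanLin u = (μ : 𝕜) • v) :
    ‖jordanWielandt A₂.toEuclideanLin (WithLp.toLp 2 (tailVec u, tailVec v)) -
        (μ : 𝕜) • WithLp.toLp 2 (tailVec u, tailVec v)‖ ≤
      ∑ j, ‖u (Sum.inl j) + v (Sum.inl j)‖ / 2 * pairNorm E F j +
        ∑ j, ‖u (Sum.inl j) - v (Sum.inl j)‖ / 2 * pairNorm E F j := by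
  have h1 := congrArg tailVec hu
  have h2 := congrArg tailVec hv
  have hs1 : tailVec ((μ : 𝕜) • u) = (μ : 𝕜) • tailVec u := rfl
  have hs2 : tailVec ((μ : 𝕜) • v) = (μ : 𝕜) • tailVec v := rfl
  rw [tailVec_blockMatrix, hs1] at h1
  rw [tailVec_blockMatrix, hs2, Matrix.toEuclideanLin_conjTranspose_eq_adjoint] at h2
  have key : jordanWielandt A₂.toEuclideanLin (WithLp.toLp 2 (tailVec u, tailVec v)) -
        (μ : 𝕜) • WithLp.toLp 2 (tailVec u, tailVec v) =
      ∑ j, ((u (Sum.inl j) - v (Sum.inl j)) / 2) • WithLp.toLp 2 (colVec F j, -colVec E j) -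
      ∑ j, ((u (Sum.inl j) + v (Sum.inl j)) / 2) • WithLp.toLp 2 (colVec F j, colVec E j) := by
    -- Uses `v_j = (u_j + v_j)/2 - (u_j - v_j)/2` against `F_j` and `u_j = (u_j + v_j)/2 + (u_j -
    -- v_j)/2` against `E_j`.
    rw [← Finset.sum_sub_distrib]
    refine WithLp.ofLp_injective 2 (Prod.ext ?_ ?_)
    · change A₂.toEuclideanLin (tailVec v) - (μ : 𝕜) • tailVec u = _
      rw [← h1, sub_add_cancel_right, ← Finset.sum_neg_distrib, WithLp.ofLp_sum, Prod.fst_sum]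
      refine Finset.sum_congr rfl fun j _ => ?_
      simp only [WithLp.ofLp_sub, WithLp.ofLp_smul, Prod.fst_sub, Prod.smul_fst]
      module
    · change A₂.toEuclideanLin.adjoint (tailVec u) - (μ : 𝕜) • tailVec v = _
      rw [← h2, sub_add_cancel_right, ← Finset.sum_neg_distrib, WithLp.ofLp_sum, Prod.snd_sum]
      refine Finset.sum_congr rfl fun j _ => ?_
      simp only [WithLp.ofLp_sub, WithLp.ofLp_smul, Prod.snd_sub, Prod.smul_snd]
      module
  rw [key, add_comm]
  refine (norm_sub_le _ _).trans (add_le_add ?_ ?_) <;>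
    refine norm_sum_le_of_le _ fun j _ => ?_
  · rw [norm_smul, norm_div, RCLike.norm_ofNat, norm_toLp_colVec_neg]
  · rw [norm_smul, norm_div, RCLike.norm_ofNat, norm_toLp_colVec]

end Block

/-! ### Assembly over the doubled index set -/

theorem sum_erase_inl {ι κ : Type*} [Fintype ι] [Fintype κ] [DecidableEq ι] [DecidableEq κ]
    (i : ι) (f : ι ⊕ κ → ℝ) :
    ∑ j ∈ Finset.univ.erase (Sum.inl i), f j =
      ∑ j ∈ Finset.univ.erase i, f (Sum.inl j) + ∑ j, f (Sum.inr j) := by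
  rw [Finset.sum_erase_eq_sub (Finset.mem_univ _), Finset.sum_erase_eq_sub (Finset.mem_univ _),
    Fintype.sum_sum_type]
  ring

theorem theorem3 {𝕜 : Type*} [RCLike 𝕜] {k p q : ℕ} (hmn : k + p ≠ k + q)
    (θ : Fin k → ℝ) (E : Matrix (Fin q) (Fin k) 𝕜) (F : Matrix (Fin p) (Fin k) 𝕜)
    (A₂ : Matrix (Fin p) (Fin q) 𝕜) (i : Fin k) (hθ : 0 ≤ θ i)
    (hδ : 0 < gapA θ E F A₂ i)
    (hδ_minus : ∀ j, j ≠ i → 0 < gapMinus θ E F i j)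
    (hδ_plus : ∀ j, 0 < gapPlus θ E F i j)
    (hd : 0 < coeffD θ E F A₂ i) :
    ∃ s, |singVal (blockMatrix θ E F A₂) s - θ i| ≤
      coeffD θ E F A₂ i * ((colNorm E i ^ 2 + colNorm F i ^ 2) / 2) := by
  obtain ⟨μ, hμ, hclose⟩ := exists_hasEigenvalue_blockMatrix θ E F A₂ i
  have hμpos : 0 < μ := by
    linarith [(abs_le.1 hclose).1, sqrt_resSq_lt θ E F A₂ hθ hδ]
  obtain ⟨s, hs⟩ := exists_singVal_eq_abs hμpos.ne' hμ
  refine ⟨s, ?_⟩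
  rw [hs, abs_of_pos hμpos]
  obtain ⟨x, hx⟩ := hμ.exists_hasEigenvector
  have hu : (blockMatrix θ E F A₂).toEuclideanLin x.snd = (μ : 𝕜) • x.fst :=
    congrArg WithLp.fst hx.apply_eq_smul
  have hv : (blockMatrix θ F E A₂ᴴ).toEuclideanLin x.fst = (μ : 𝕜) • x.snd := by
    rw [← adjoint_toEuclideanLin_blockMatrix]
    exact congrArg WithLp.snd hx.apply_eq_smul
  set u := x.fst
  set v := x.snd
  set y := WithLp.toLp 2 (tailVec u, tailVec v)
  have hne : ¬ (‖y‖ = 0 ∧ ∀ j, Sum.elim (fun j => ‖u (Sum.inl j) + v (Sum.inl j)‖ / 2)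
      (fun j => ‖u (Sum.inl j) - v (Sum.inl j)‖ / 2) j = 0) := by
    rintro ⟨hy, hc⟩
    rw [norm_eq_zero] at hy
    have hadd : ∀ j, u (Sum.inl j) + v (Sum.inl j) = 0 := fun j => by
      simpa using hc (Sum.inl j)
    have hsub : ∀ j, u (Sum.inl j) = v (Sum.inl j) := fun j => by
      simpa [sub_eq_zero] using hc (Sum.inr j)
    have hv0 : ∀ j, v (Sum.inl j) = 0 := fun j => by
      simpa [hsub j, ← two_mul] using hadd j
    have htu : tailVec u = 0 := congrArg WithLp.fst hy
    have htv : tailVec v = 0 := congrArg WithLp.snd hy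
    refine hx.2 (WithLp.ofLp_injective 2 (Prod.ext (PiLp.ext ?_) (PiLp.ext ?_)))
    · rintro (j | a)
      · exact (hsub j).trans (hv0 j)
      · exact congrArg (fun w => w.ofLp a) htu
    · rintro (j | a)
      · exact hv0 j
      · exact congrArg (fun w => w.ofLp a) htv
  have hgapA : gapA θ E F A₂ i * ‖y‖ ≤
      ‖jordanWielandt A₂.toEuclideanLin y - (μ : 𝕜) • y‖ := by
    refine (isSymmetric_jordanWielandt _).mul_norm_le_norm_sub (fun l hl => ?_) y
    -- The `√` subtracted in `gapA` pays for moving the reference point from `θ i` to `μ`.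
    have h1 := gapA_add_le_abs θ E F A₂ hθ hl
    have h2 := abs_sub_le l μ (θ i)
    linarith
  have hden : gapA θ E F A₂ i - ∑ j ∈ Finset.univ.erase (Sum.inl i : Fin k ⊕ Fin k),
      Sum.elim (pairNorm E F) (pairNorm E F) j ^ 2 /
        (2 * Sum.elim (gapMinus θ E F i) (gapPlus θ E F i) j) =
      gapA θ E F A₂ i
      - ∑ j ∈ Finset.univ.erase i,
          (colNorm E j ^ 2 + colNorm F j ^ 2) / (2 * gapMinus θ E F i j)
      - ∑ j : Fin k, (colNorm E j ^ 2 + colNorm F j ^ 2) / (2 * gapPlus θ E F i j) := by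
    rw [sum_erase_inl, ← sub_sub]
    simp only [Sum.elim_inl, Sum.elim_inr, pairNorm_sq]
  rw [coeffD, ← hden, ← pairNorm_sq]
  rw [coeffD, ← hden] at hd
  -- `inl j` stands for `u_j + v_j`, near `θ j`, and `inr j` for `u_j - v_j`, near `-θ j`; only `inl
  -- i` lacks a gap.
  refine le_of_block_eigenvector_estimates (Sum.inl i) (n := ‖y‖)
    (c := Sum.elim (fun j => ‖u (Sum.inl j) + v (Sum.inl j)‖ / 2)
      (fun j => ‖u (Sum.inl j) - v (Sum.inl j)‖ / 2))
    (t := Sum.elim (fun j => |μ - θ j|) (fun j => |μ + θ j|))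
    (norm_nonneg _) ?_ ?_ hne ?_ ?_ ?_ ?_ (one_div_pos.1 hd)
  · rintro (j | j) <;> simp only [Sum.elim_inl, Sum.elim_inr] <;> positivity
  · rintro (j | j) <;> exact Real.sqrt_nonneg _
  · rintro (j | j) hj
    · exact hδ_minus j fun h => hj (congrArg _ h)
    · exact hδ_plus j
  · rintro (j | j) -
    · have := abs_sub_le (θ i) μ (θ j)
      rw [abs_sub_comm (θ i) μ] at this
      simp only [Sum.elim_inl, gapMinus]
      linarith
    · have := abs_sub_le (θ i) μ (-θ j)
      rw [abs_sub_comm (θ i) μ, sub_neg_eq_add, sub_neg_eq_add] at this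
      simp only [Sum.elim_inr, gapPlus]
      linarith
  · rintro (j | j)
    · exact abs_sub_mul_norm_add_le hu hv j
    · exact abs_add_mul_norm_sub_le hu hv j
  · rw [Fintype.sum_sum_type]
    exact hgapA.trans (norm_jordanWielandt_tail_sub_le hu hv)
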